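/- For $n \ge 2$, let $L_n$ be the triplet group $$L_n = \langle y_1, \ldots, y_{n-1} \mid y_j^2 = 1 \ (1 \le j \le n-1),\ \ y_i y_{i+1} y_i = y_{i+1} y_i y_{i+1} \ (1 \le i \le n-2) \rangle,$$ and let the pure triplet group $PL_n$ be the kernel of the natural surjection $L_n \to S_n$ onto the symmetric group that sends $y_i$ to the adjacent transposition $(i\ \ i+1)$. Then, for every $n \ge 4$, the group $PL_n$ is isomorphic to the free group of rank $$1 + n!\left(\frac{2n-7}{6}\right).$$ In particular, $PL_4$ is free of rank $5$ and $PL_5$ is free of rank $61$. -/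

import Mathlib

/-- The defining relators of the triplet group `L_n`, as words in the free group on the letters
`y_0, …, y_{n-2}` (the standard letters `y_1, …, y_{n-1}`, shifted by one):
`y_j ^ 2` for every `j`, and `(y_i y_{i+1} y_i) (y_{i+1} y_i y_{i+1})⁻¹` for every pair of
consecutive indices. -/
def tripletRels (n : ℕ) : Set (FreeGroup (Fin (n - 1))) :=
  {w | ∃ j : Fin (n - 1), w = FreeGroup.of j ^ 2} ∪
  {w | ∃ i j : Fin (n - 1), (i : ℕ) + 1 = (j : ℕ) ∧
    w = (FreeGroup.of i * FreeGroup.of j * FreeGroup.of i) *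
      (FreeGroup.of j * FreeGroup.of i * FreeGroup.of j)⁻¹}

/-- The triplet group `L_n`, given by its presentation. -/
abbrev TripletGroup (n : ℕ) : Type := PresentedGroup (tripletRels n)

/-- The adjacent transposition of `S_n` that exchanges the points `i` and `i + 1`
(points are numbered from `0` to `n - 1`). -/
def adjSwap (n : ℕ) (i : Fin (n - 1)) : Equiv.Perm (Fin n) :=
  Equiv.swap ⟨i, by omega⟩ ⟨i + 1, by omega⟩

/-- The adjacent transpositions satisfy the relations of the triplet group. -/
theorem adjSwap_rels (n : ℕ) :
    ∀ w ∈ tripletRels n, FreeGroup.lift (adjSwap n) w = 1 := by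
  rintro w (⟨j, rfl⟩ | ⟨i, j, hij, rfl⟩)
  · simp [adjSwap, pow_two]
  · simp only [map_mul, map_inv, FreeGroup.lift_apply_of, mul_inv_eq_one]
    have hi := i.isLt
    have hj := j.isLt
    have e : adjSwap n j = Equiv.swap ⟨i + 1, by omega⟩ ⟨i + 2, by omega⟩ := by
      simp only [adjSwap]
      congr 2 <;> omega
    have key : ∀ a b c : Fin n, a ≠ b → a ≠ c → b ≠ c →
        Equiv.swap a b * Equiv.swap b c * Equiv.swap a b =
          Equiv.swap b c * Equiv.swap a b * Equiv.swap b c := by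
      intro a b c hab hac hbc
      rw [Equiv.swap_mul_swap_mul_swap hab hac, Equiv.swap_comm a b, Equiv.swap_comm b c,
        Equiv.swap_mul_swap_mul_swap hbc.symm hac.symm, Equiv.swap_comm]
    rw [e, adjSwap]
    exact key _ _ _ (by simp) (by simp) (by simp)

/-- The natural homomorphism `L_n → S_n` that sends each generator to the corresponding
adjacent transposition. -/
def tripletToPerm (n : ℕ) : TripletGroup n →* Equiv.Perm (Fin n) :=
  PresentedGroup.toGroup (adjSwap_rels n)

/-- The pure triplet group `PL_n`, the kernel of the natural homomorphism `L_n → S_n`. -/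
abbrev PureTripletGroup (n : ℕ) : Subgroup (TripletGroup n) := (tripletToPerm n).ker

/-! Let `L_n` act on `Q = S_n` by left translation. The vertex group of the action groupoid is the
kernel `PL_n`, so it suffices to show that this groupoid is free and to count its generating arrows.

Functors from the groupoid to a group `X` are crossed homomorphisms, that is, labellings `f i b` of
the Cayley graph edges (generator `i`, target `b`) compatible with the relators. The relations `y_i
^ 2 = 1` say that labels at odd targets are inverses of labels at even ones. Now replace `f (k+1)`
by the label `g k` of the path `y_{k+1} y_k`. This is a triangular change of variables, after which
each braid relation says only that `g k` multiplies to `1` around every orbit of the order-3 element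
`s k * s (k+1)`. Solving for one value per orbit leaves free parameters: `|Q|/2` values of `f 0`
and, with `n = m + 2`, `|Q|/3` values of each of the `m` functions `g k`.

A connected free groupoid has free vertex groups (Nielsen–Schreier) of rank arrows − vertices + 1,
here `|Q| (3 + 2m)/6 - |Q| + 1`. -/

open CategoryTheory Quiver

/-! ### Vertex groups of free groupoids and their rank -/

/-- Functors from a connected groupoid to a group correspond to homomorphisms from a vertex group
together with an arbitrary labelling of the other vertices. -/
noncomputable def functorEquivEndHomProd {G : Type} [Groupoid.{0} G] [IsConnected G] (r : G)
    (X : Type) [Group X] :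
    (G ⥤ CategoryTheory.SingleObj X) ≃ (End r →* X) × ({a : G // a ≠ r} → X) := by
  classical
  -- A star of chosen arrows out of `r`, serving as a spanning tree. It must be the identity at `r`
  -- for the two constructions to be inverse.
  let t : ∀ a : G, r ⟶ a := fun a => if h : a = r then eqToHom h.symm else
    (nonempty_hom_of_preconnected_groupoid r a).some
  have ht : t r = 𝟙 r := by simp [t]
  let ext : ({a : G // a ≠ r} → X) → G → X := fun f a => if h : a = r then 1 else f ⟨a, h⟩
  have hext : ∀ f, ext f r = 1 := fun f => by simp [ext]
  refine
    { toFun := fun F => ⟨⟨⟨fun p => (F.map p : X), F.map_id r⟩, fun p q => F.map_comp q p⟩,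
        fun a => (F.map (t a) : X)⟩
      invFun := fun p =>
        { obj := fun _ => CategoryTheory.SingleObj.star X
          map := fun {a b} g =>
            (ext p.2 b * p.1 (show End r from t a ≫ g ≫ inv (t b)) * (ext p.2 a)⁻¹ : X)
          map_id := ?_
          map_comp := ?_ }
      left_inv := ?_
      right_inv := ?_ }
  · intro a
    have : (show End r from t a ≫ 𝟙 a ≫ inv (t a)) = 1 := by simp [End.one_def]
    rw [this, map_one, mul_one, mul_inv_cancel]
    rfl
  · intro a b c g h
    have : (show End r from t a ≫ (g ≫ h) ≫ inv (t c)) =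
        (show End r from t b ≫ h ≫ inv (t c)) * (show End r from t a ≫ g ≫ inv (t b)) := by
      simp [End.mul_def]
    rw [this, map_mul, CategoryTheory.SingleObj.comp_as_mul]
    group
  · intro F
    refine Functor.hext (fun _ => rfl) fun a b g => heq_of_eq ?_
    have hF : ∀ a, ext (fun a => (F.map (t a) : X)) a = (F.map (t a) : X) := by
      intro a
      by_cases h : a = r
      · subst h
        have : F.map (t a) = F.map (𝟙 a) := by rw [ht]
        exact (hext fun b => (F.map (t b) : X)).trans (this.trans (F.map_id a)).symm
      · simp [ext, h]
    change (ext (fun a => (F.map (t a) : X)) b * (F.map (t a ≫ g ≫ inv (t b)) : X) *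
      (ext (fun a => (F.map (t a) : X)) a)⁻¹ : X) = F.map g
    rw [hF, hF, F.map_comp, F.map_comp, Functor.map_inv, CategoryTheory.SingleObj.comp_as_mul,
      CategoryTheory.SingleObj.comp_as_mul, CategoryTheory.SingleObj.inv_as_inv]
    group
  · rintro ⟨φ, f⟩
    refine Prod.ext (MonoidHom.ext fun p => ?_) (funext fun a => ?_)
    · change ext f r * φ (show End r from t r ≫ p ≫ inv (t r)) * (ext f r)⁻¹ = φ p
      have : (show End r from t r ≫ p ≫ inv (t r)) = p := by simp [ht]
      rw [this, hext]
      simp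
    · change ext f a * φ (show End r from t r ≫ t a ≫ inv (t a)) * (ext f r)⁻¹ = f a
      have : (show End r from t r ≫ t a ≫ inv (t a)) = 1 := by simp [ht, End.one_def]
      rw [this, hext, map_one]
      simp [ext, a.2]

/-- Functors from a free groupoid to a group correspond to labellings of its generating arrows. -/
noncomputable def functorEquivLabelling {G : Type} [Groupoid.{0} G] [IsFreeGroupoid G]
    (X : Type) [Group X] :
    (G ⥤ CategoryTheory.SingleObj X) ≃ (Total (IsFreeGroupoid.Generators G) → X) :=
  Equiv.ofBijective (fun F e => (F.map (IsFreeGroupoid.of e.hom) : X)) <| by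
    refine Function.bijective_iff_existsUnique _ |>.2 fun f => ?_
    obtain ⟨F, hF, hu⟩ := IsFreeGroupoid.unique_lift (G := G) (X := X) fun a b e => f ⟨a, b, e⟩
    exact ⟨F, funext fun e => hF _ _ _, fun F' h => hu _ fun a b e => congrFun h ⟨a, b, e⟩⟩

/-- A vertex group of a finite connected free groupoid is free, and its rank is the first Betti
number of the generating quiver. -/
theorem IsFreeGroupoid.exists_end_mulEquiv {G : Type} [Groupoid.{0} G] [IsConnected G]
    [IsFreeGroupoid G] [Finite G] [Finite (Total (IsFreeGroupoid.Generators G))] (r : G) :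
    ∃ k : ℕ, k + Nat.card G = Nat.card (Total (IsFreeGroupoid.Generators G)) + 1 ∧
      Nonempty (End r ≃* FreeGroup (Fin k)) := by
  classical
  -- The rank is found by counting functors to a group of order two in both descriptions and
  -- comparing exponents of 2.
  let X := Multiplicative (ZMod 2)
  let ι := IsFreeGroup.Generators (End r)
  have hX : Nat.card X = 2 := by simp [X]
  let e : (ι → X) × ({a : G // a ≠ r} → X) ≃ (Total (IsFreeGroupoid.Generators G) → X) :=
    ((Equiv.prodCongr IsFreeGroup.lift (Equiv.refl _)).trans
      (functorEquivEndHomProd r X).symm).trans (functorEquivLabelling X)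
  have : Finite ((ι → X) × ({a : G // a ≠ r} → X)) := Finite.of_equiv _ e.symm
  have : Finite (ι → X) := Finite.prod_left ({a : G // a ≠ r} → X)
  have : Finite ι := by
    refine Finite.of_injective (fun i : ι => (Pi.mulSingle i (Multiplicative.ofAdd 1) : ι → X)) ?_
    intro i j h
    by_contra hij
    have := congrFun h i
    simp only [Pi.mulSingle_eq_same, Pi.mulSingle_eq_of_ne hij] at this
    revert this
    decide
  have hc := Nat.card_congr e
  rw [Nat.card_prod, Nat.card_fun, Nat.card_fun, Nat.card_fun, hX, ← pow_add] at hc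
  have hc := Nat.pow_right_injective le_rfl hc
  have hG : Nat.card {a : G // a ≠ r} + 1 = Nat.card G := by
    have := Fintype.ofFinite G
    rw [Nat.card_eq_fintype_card, Nat.card_eq_fintype_card, Fintype.card_subtype_compl]
    simp only [Fintype.card_unique]
    exact Nat.sub_add_cancel (Fintype.card_pos_iff.2 ⟨r⟩)
  refine ⟨Nat.card ι, by omega, ⟨(IsFreeGroup.toFreeGroup (End r)).trans ?_⟩⟩
  exact FreeGroup.freeGroupCongr (Finite.equivFin ι)

/-! ### Action groupoids and crossed homomorphisms -/

open SemidirectProduct ActionCategory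

/-- The quiver on an action groupoid whose arrows with target `b` are the pairs `(e, b)` satisfying
a given condition, with `(e, b)` starting at `(g e)⁻¹ • b`. -/
abbrev actionQuiver {L A E : Type} [Group L] [MulAction L A] (g : E → L) (P : E → A → Prop) :
    Quiver.{0} (IsFreeGroupoid.Generators (ActionCategory L A)) :=
  ⟨fun a b => { e : E // P e (ActionCategory.back (M := L) b) ∧
    g e • ActionCategory.back (M := L) a = ActionCategory.back (M := L) b }⟩

/-- An action groupoid is free on a family of arrows once crossed homomorphisms are uniquely
determined by their values on these arrows. -/
abbrev isFreeGroupoidAction {L A E : Type} [Group L] [MulAction L A] (g : E → L)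
    (P : E → A → Prop)
    (h : ∀ (X : Type) [Group X] (f : E → A → X), ∃! φ : L →* (A → X) ⋊[mulAutArrow] L,
      rightHom.comp φ = MonoidHom.id L ∧ ∀ e b, P e b → (φ (g e)).left b = f e b) :
    IsFreeGroupoid (ActionCategory L A) where
  quiverGenerators := actionQuiver g P
  of := fun e => ⟨g e.1, e.2.2⟩
  unique_lift := by
    classical
    intro X _ f
    -- The value `1` outside `P` is never used.
    let f' : E → A → X := fun e b =>
      if hp : P e b then @f ⟨(), (g e)⁻¹ • b⟩ ⟨(), b⟩ ⟨e, hp, smul_inv_smul (g e) b⟩ else 1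
    obtain ⟨φ, ⟨hφ, hφ'⟩, hu⟩ := h X f'
    refine ⟨uncurry φ fun x => DFunLike.congr_fun hφ x, ?_, ?_⟩
    · rintro ⟨⟨⟩, a : A⟩ ⟨⟨⟩, b⟩ ⟨e, hp : P e b, he : g e • a = b⟩
      change (φ (g e)).left b = _
      rw [hφ' _ _ hp]
      cases inv_smul_eq_iff.mpr he.symm
      exact dif_pos hp
    · intro F hF
      have : curry F = φ := by
        refine hu _ ⟨rfl, fun e b hp => ?_⟩
        have hf : f' e b = @f ⟨(), (g e)⁻¹ • b⟩ ⟨(), b⟩ ⟨e, hp, smul_inv_smul (g e) b⟩ :=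
          dif_pos hp
        rw [hf]
        exact hF ⟨(), (g e)⁻¹ • b⟩ ⟨(), b⟩ ⟨e, hp, smul_inv_smul (g e) b⟩
      apply Functor.hext
      · intro
        apply Unit.ext
      · refine ActionCategory.cases ?_
        intro t x
        subst this
        rfl

/-- The arrows of `actionQuiver`. -/
def totalActionQuiverEquiv {L A E : Type} [Group L] [MulAction L A] (g : E → L)
    (P : E → A → Prop) :
    @Total (IsFreeGroupoid.Generators (ActionCategory L A)) (actionQuiver g P) ≃
      Σ e : E, {b : A // P e b} := by
  letI := actionQuiver g P
  exact
    { toFun := fun t => ⟨t.hom.1, ⟨ActionCategory.back (M := L) t.right, t.hom.2.1⟩⟩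
      invFun := fun p => ⟨⟨(), (g p.1)⁻¹ • p.2.1⟩, ⟨(), p.2.1⟩,
        ⟨p.1, p.2.2, smul_inv_smul (g p.1) p.2.1⟩⟩
      left_inv := by
        rintro ⟨⟨⟨⟩, a : A⟩, ⟨⟨⟩, b⟩, ⟨e, hp : P e b, he : g e • a = b⟩⟩
        cases inv_smul_eq_iff.mpr he.symm
        rfl
      right_inv := fun _ => rfl }

/-- For a permutation `c` of a finite set that moves every point and has `c ^ 3 = 1`, a set of
representatives of the orbits of `c`. -/
theorem exists_orbit_representatives {A : Type} [Finite A] (c : Equiv.Perm A)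
    (hc : ∀ a, c (c (c a)) = a) (hf : ∀ a, c a ≠ a) :
    ∃ R : A → Prop, ∀ a, (R a ∧ ¬ R (c a) ∧ ¬ R (c (c a))) ∨ (¬ R a ∧ R (c a) ∧ ¬ R (c (c a))) ∨
      (¬ R a ∧ ¬ R (c a) ∧ R (c (c a))) := by
  let e := Finite.equivFin A
  -- The representative is the least element of its three-element orbit in an arbitrary enumeration.
  refine ⟨fun a => e a < e (c a) ∧ e a < e (c (c a)), fun a => ?_⟩
  have h1 : e a ≠ e (c a) := fun h => hf a (e.injective h).symm
  have h2 : e (c a) ≠ e (c (c a)) := fun h => hf _ (e.injective h).symm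
  have h3 : e (c (c a)) ≠ e a := fun h => hf (c (c a)) (by rw [hc]; exact (e.injective h).symm)
  simp only [hc]
  omega

/-! ### Edge labellings and the chain presentation -/

/-- Presentation data of a chain of copies of `S₃` glued along the subgroups generated by
consecutive involutions. -/
def chainRels (m : ℕ) : Set (FreeGroup (Fin (m + 1))) :=
  {w | ∃ j : Fin (m + 1), w = FreeGroup.of j ^ 2} ∪
  {w | ∃ k : Fin m,
    w = (FreeGroup.of k.castSucc * FreeGroup.of k.succ * FreeGroup.of k.castSucc) *
      (FreeGroup.of k.succ * FreeGroup.of k.castSucc * FreeGroup.of k.succ)⁻¹}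

theorem tripletRels_eq_chainRels (m : ℕ) : tripletRels (m + 2) = chainRels m := by
  refine congrArg₂ _ rfl (Set.ext fun w => ⟨?_, ?_⟩)
  · rintro ⟨i, j, hij, rfl⟩
    have hj := j.isLt
    refine ⟨⟨i, by omega⟩, ?_⟩
    have h1 : (⟨i, by omega⟩ : Fin m).castSucc = i := rfl
    have h2 : (⟨i, by omega⟩ : Fin m).succ = j := Fin.ext hij
    rw [h1, h2]
  · rintro ⟨k, rfl⟩
    exact ⟨k.castSucc, k.succ, rfl, rfl⟩

section Chain

variable {m : ℕ} {Q : Type} [Group Q]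

/-- An edge labelling of the Cayley graph of `Q` that satisfies all relations can be prescribed on
the even targets of the `s 0`-edges and by the labels `g k` of the even paths of length two, as long
as the latter multiply to `1` along each orbit of `s k * s (k + 1)`. -/
theorem exists_edge_labels (s : Fin (m + 1) → Q) (hs : ∀ i, s i * s i = 1)
    (hb : ∀ k : Fin m, s k.castSucc * s k.succ * s k.castSucc = s k.succ * s k.castSucc * s k.succ)
    (ε : Q →* ℤˣ) (hε : ∀ i, ε (s i) = -1) {X : Type} [Group X]
    (f₀ : Q → X) (g : Fin m → Q → X)
    (hg : ∀ k b, g k b * g k (s k.castSucc * s k.succ * b) *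
      g k (s k.castSucc * s k.succ * (s k.castSucc * s k.succ * b)) = 1) :
    ∃ f : Fin (m + 1) → Q → X, (∀ i b, f i b * f i (s i * b) = 1) ∧
      (∀ k : Fin m, ∀ b, f k.castSucc b * f k.succ (s k.castSucc * b) *
          f k.castSucc (s k.succ * (s k.castSucc * b)) =
        f k.succ b * f k.castSucc (s k.succ * b) *
          f k.succ (s k.castSucc * (s k.succ * b))) ∧
      (∀ b, ε b = 1 → f 0 b = f₀ b) ∧
      ∀ k b, ε b = 1 → f k.succ b * f k.castSucc (s k.succ * b) = g k b := by
  classical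
  have hs' : ∀ i b, s i * (s i * b) = b := fun i b => by rw [← mul_assoc, hs, one_mul]
  -- Even labels, obtained by solving `g k b = f (k+1) b * f k (s (k+1) * b)` for `f (k+1)`; the
  -- last factor is the inverse of `f k` at `s k * s (k+1) * b`.
  let F : Fin (m + 1) → Q → X := Fin.induction (motive := fun _ => Q → X) f₀
    fun k F b => g k b * F (s k.castSucc * s k.succ * b)
  have F_succ : ∀ k b, F (Fin.succ k) b = g k b * F k.castSucc (s k.castSucc * s k.succ * b) :=
    fun k b => rfl
  let f : Fin (m + 1) → Q → X := fun i b => if ε b = 1 then F i b else (F i (s i * b))⁻¹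
  have odd : ∀ i b, ε b = 1 → ε (s i * b) ≠ 1 := by
    intro i b h
    rw [map_mul, hε, h]
    decide
  have even : ∀ i b, ε b ≠ 1 → ε (s i * b) = 1 := by
    intro i b h
    rw [map_mul, hε, (Int.units_eq_one_or (ε b)).resolve_left h]
    decide
  have f_even : ∀ i b, ε b = 1 → f i b = F i b := fun i b h => if_pos h
  have f_odd : ∀ i j b, ε b = 1 → f i (s j * b) = (F i (s i * (s j * b)))⁻¹ :=
    fun i j b h => if_neg (odd j b h)
  have even2 : ∀ i j b, ε b = 1 → ε (s i * (s j * b)) = 1 := fun i j b h => even _ _ (odd _ _ h)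
  have hF : ∀ k : Fin m, ∀ b,
      g k b = F k.succ b * (F k.castSucc (s k.castSucc * (s k.succ * b)))⁻¹ := by
    intro k b
    rw [F_succ, mul_assoc (s _)]
    group
  have hcc : ∀ (k : Fin m) b, s k.castSucc * (s k.succ * (s k.castSucc * (s k.succ * b))) =
      s k.succ * (s k.castSucc * b) := by
    intro k b
    have := congrArg (fun x => x * (s k.succ * b)) (hb k)
    simpa only [mul_assoc, hs'] using this
  have hcc' : ∀ (k : Fin m) b, s k.succ * (s k.castSucc * (s k.succ * (s k.castSucc * b))) =
      s k.castSucc * (s k.succ * b) := by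
    intro k b
    have := congrArg (fun x => x * (s k.castSucc * b)) (hb k)
    simpa only [mul_assoc, hs'] using this.symm
  refine ⟨f, fun i b => ?_, fun k b => ?_, fun b h => f_even 0 b h, fun k b h => ?_⟩
  · by_cases h : ε b = 1
    · rw [f_even _ _ h, f_odd _ _ _ h, hs', mul_inv_cancel]
    · rw [f_even _ _ (even i b h), show f i b = _ from if_neg h, inv_mul_cancel]
  -- Substituting `hF` turns the orbit relation for `g k` into the relation around the braid hexagon
  -- through `b`.
  · by_cases h : ε b = 1
    · have := hg k b
      rw [hF, hF, hF] at this
      simp only [mul_assoc, hcc, hs'] at this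
      rw [f_even _ _ h, f_even _ _ h, f_odd _ _ _ h, f_odd _ _ _ h, f_even _ _ (even2 _ _ _ h),
        f_even _ _ (even2 _ _ _ h)]
      rw [← mul_assoc, ← mul_assoc] at this
      rw [eq_inv_of_mul_eq_one_left this]
      group
    -- An odd vertex lies on the same hexagon as its even neighbour, whose orbit relation suffices.
    · obtain ⟨b, rfl⟩ : ∃ b', b = s k.castSucc * b' := ⟨_, (hs' k.castSucc b).symm⟩
      have h : ε b = 1 := by simpa only [hs'] using even k.castSucc _ h
      have := hg k b
      rw [hF, hF, hF] at this
      simp only [mul_assoc, hcc, hs'] at this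
      have hbr : s k.castSucc * (s k.succ * (s k.castSucc * b)) =
          s k.succ * (s k.castSucc * (s k.succ * b)) := by
        simpa only [mul_assoc] using congrArg (· * b) (hb k)
      rw [hbr, hs', f_odd _ _ _ h, f_even _ _ h, f_odd _ _ _ h, f_odd _ _ _ h,
        f_even _ _ (even2 _ _ _ h), f_odd _ _ _ (even2 _ _ _ h), hs', hs']
      rw [← mul_assoc] at this
      rw [mul_assoc, eq_inv_of_mul_eq_one_left this]
      group
  · rw [f_even _ _ h, f_odd _ _ _ h, hF]

theorem crossed_mul_left {L A X : Type} [Group L] [MulAction L A] [Group X]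
    (x y : (A → X) ⋊[mulAutArrow] L) (b : A) :
    (x * y).left b = x.left b * y.left (x.right⁻¹ • b) := rfl

theorem cube_eq_one_of_braid {x y : Q} (hx : x * x = 1) (hy : y * y = 1)
    (hxy : x * y * x = y * x * y) : x * y * (x * y) * (x * y) = 1 :=
  calc x * y * (x * y) * (x * y) = x * y * x * (y * x * y) := by group
    _ = y * x * (y * y) * x * y := by rw [hxy]; group
    _ = y * (x * x) * y := by rw [hy]; group
    _ = 1 := by rw [hx, mul_one, hy]

theorem of_mul_self_chain (m : ℕ) (i : Fin (m + 1)) :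
    (PresentedGroup.of i * PresentedGroup.of i : PresentedGroup (chainRels m)) = 1 := by
  rw [← pow_two]
  exact PresentedGroup.one_of_mem (Or.inl ⟨i, rfl⟩)

theorem of_braid_chain (m : ℕ) (k : Fin m) :
    (PresentedGroup.of k.castSucc * PresentedGroup.of k.succ * PresentedGroup.of k.castSucc :
      PresentedGroup (chainRels m)) =
    PresentedGroup.of k.succ * PresentedGroup.of k.castSucc * PresentedGroup.of k.succ :=
  mul_inv_eq_one.1 (PresentedGroup.one_of_mem (Or.inr ⟨k, rfl⟩))

/-- The elements of the presented group that label the generating arrows of its action groupoid. -/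
def chainArrow (m : ℕ) : Option (Fin m) → PresentedGroup (chainRels m)
  | none => PresentedGroup.of 0
  | some k => PresentedGroup.of k.succ * PresentedGroup.of k.castSucc

/-- The targets of the generating arrows of the action groupoid. -/
def chainTarget {m : ℕ} (ε : Q →* ℤˣ) (R : Fin m → Q → Prop) : Option (Fin m) → Q → Prop
  | none, b => ε b = 1
  | some k, b => ε b = 1 ∧ ¬ R k b

/-- A crossed homomorphism on the presented group is uniquely determined by its values on the
generating arrows, which can be prescribed arbitrarily. -/
theorem existsUnique_crossedHom (π : PresentedGroup (chainRels m) →* Q)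
    (ε : Q →* ℤˣ) (hε : ∀ i, ε (π (PresentedGroup.of i)) = -1) (R : Fin m → Q → Prop)
    (hR : ∀ k a, let c := π (PresentedGroup.of k.castSucc) * π (PresentedGroup.of k.succ)
      (R k a ∧ ¬ R k (c * a) ∧ ¬ R k (c * (c * a))) ∨
      (¬ R k a ∧ R k (c * a) ∧ ¬ R k (c * (c * a))) ∨
      (¬ R k a ∧ ¬ R k (c * a) ∧ R k (c * (c * a))))
    (X : Type) [Group X] (l : Option (Fin m) → Q → X) :
    letI : MulAction (PresentedGroup (chainRels m)) Q := MulAction.compHom Q π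
    ∃! φ : PresentedGroup (chainRels m) →* (Q → X) ⋊[mulAutArrow] PresentedGroup (chainRels m),
      rightHom.comp φ = MonoidHom.id _ ∧
        ∀ e b, chainTarget ε R e b → (φ (chainArrow m e)).left b = l e b := by
  classical
  let _ : MulAction (PresentedGroup (chainRels m)) Q := MulAction.compHom Q π
  set s : Fin (m + 1) → Q := fun i => π (PresentedGroup.of i) with s_def
  have smul_def : ∀ (x : PresentedGroup (chainRels m)) (b : Q), x • b = π x * b := fun _ _ => rfl
  have hs : ∀ i, s i * s i = 1 := fun i => by
    rw [s_def, ← map_mul, of_mul_self_chain, map_one]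
  have hs' : ∀ i b, s i * (s i * b) = b := fun i b => by rw [← mul_assoc, hs, one_mul]
  have hinv : ∀ i, (s i)⁻¹ = s i := fun i => inv_eq_of_mul_eq_one_left (hs i)
  have hb : ∀ k : Fin m, s k.castSucc * s k.succ * s k.castSucc =
      s k.succ * s k.castSucc * s k.succ := fun k => by
    simp only [s_def, ← map_mul, of_braid_chain]
  have hccc : ∀ (k : Fin m) b, s k.castSucc * s k.succ *
      (s k.castSucc * s k.succ * (s k.castSucc * s k.succ * b)) = b := by
    intro k b
    rw [← mul_assoc, ← mul_assoc, cube_eq_one_of_braid (hs _) (hs _) (hb k), one_mul]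
  refine existsUnique_of_exists_of_unique ?_ ?_
  · obtain ⟨f, hsq, hbr, h0, hk⟩ := exists_edge_labels s hs hb ε hε (l none)
      -- At a representative the value is forced by the other two in its orbit.
      (fun k b => if R k b then
        (l (some k) (s k.castSucc * s k.succ * b) *
          l (some k) (s k.castSucc * s k.succ * (s k.castSucc * s k.succ * b)))⁻¹
        else l (some k) b) (by
        intro k b
        simp only [hccc]
        rcases hR k b with ⟨h1, h2, h3⟩ | ⟨h1, h2, h3⟩ | ⟨h1, h2, h3⟩
        all_goals
          simp only [s_def] at h1 h2 h3 ⊢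
          simp only [h1, h2, h3, if_true, if_false]
          group)
    -- Crossed homomorphisms are sections of the semidirect product, so the relators need checking
    -- only on these lifts of the generators.
    let u : Fin (m + 1) → (Q → X) ⋊[mulAutArrow] PresentedGroup (chainRels m) :=
      fun i => ⟨f i, PresentedGroup.of i⟩
    have u_mul : ∀ i y b, (u i * y).left b = f i b * y.left (s i * b) := by
      intro i y b
      rw [crossed_mul_left, smul_def, map_inv]
      exact congrArg (fun z => f i b * y.left (z * b)) (hinv i)
    have hu : ∀ w ∈ chainRels m, FreeGroup.lift u w = 1 := by
      rintro w (⟨i, rfl⟩ | ⟨k, rfl⟩)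
      · rw [map_pow, FreeGroup.lift_apply_of, pow_two]
        refine SemidirectProduct.ext (funext fun b => ?_) (of_mul_self_chain m i)
        rw [u_mul]
        exact hsq i b
      · simp only [map_mul, map_inv, FreeGroup.lift_apply_of, mul_inv_eq_one]
        refine SemidirectProduct.ext (funext fun b => ?_) (of_braid_chain m k)
        rw [mul_assoc, mul_assoc, u_mul, u_mul, u_mul, u_mul, ← mul_assoc (f _ _),
          ← mul_assoc (f _ _)]
        exact hbr k b
    refine ⟨PresentedGroup.toGroup hu, ?_, ?_⟩
    · refine PresentedGroup.ext fun i => ?_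
      simp [u]
    · rintro (_ | k) b hP
      · simp only [chainArrow, PresentedGroup.toGroup.of]
        exact h0 b hP
      · simp only [chainArrow, map_mul, PresentedGroup.toGroup.of]
        rw [u_mul]
        exact (hk k b hP.1).trans (if_neg hP.2)
  · rintro φ ψ ⟨hφ, hφ'⟩ ⟨hψ, hψ'⟩
    have left_mul : ∀ χ : PresentedGroup (chainRels m) →* (Q → X) ⋊[mulAutArrow]
        PresentedGroup (chainRels m), rightHom.comp χ = MonoidHom.id _ →
        ∀ x y b, (χ (x * y)).left b = (χ x).left b * (χ y).left ((π x)⁻¹ * b) := by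
      intro χ hχ x y b
      have hx : (χ x).right = x := DFunLike.congr_fun hχ x
      rw [map_mul, crossed_mul_left, hx, smul_def, map_inv]
    have odd_eq : ∀ χ : PresentedGroup (chainRels m) →* (Q → X) ⋊[mulAutArrow]
        PresentedGroup (chainRels m), rightHom.comp χ = MonoidHom.id _ →
        ∀ i b, (χ (PresentedGroup.of i)).left b =
          ((χ (PresentedGroup.of i)).left (s i * b))⁻¹ := by
      intro χ hχ i b
      have := left_mul χ hχ (PresentedGroup.of i) (PresentedGroup.of i) b
      rw [of_mul_self_chain, map_one] at this
      rw [← hinv i]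
      exact eq_inv_of_mul_eq_one_left this.symm
    have three : ∀ χ : PresentedGroup (chainRels m) →* (Q → X) ⋊[mulAutArrow]
        PresentedGroup (chainRels m), rightHom.comp χ = MonoidHom.id _ →
        ∀ k b, (χ (chainArrow m (some k))).left b =
          ((χ (chainArrow m (some k))).left (s k.castSucc * s k.succ * b) *
          (χ (chainArrow m (some k))).left
            (s k.castSucc * s k.succ * (s k.castSucc * s k.succ * b)))⁻¹ := by
      intro χ hχ k b
      have hw : (π (chainArrow m (some k)))⁻¹ = s k.castSucc * s k.succ := by
        rw [chainArrow, map_mul, mul_inv_rev]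
        exact congrArg₂ _ (hinv _) (hinv _)
      have hw3 : chainArrow m (some k) * (chainArrow m (some k) * chainArrow m (some k)) = 1 := by
        rw [← mul_assoc]
        exact cube_eq_one_of_braid (of_mul_self_chain _ _) (of_mul_self_chain _ _)
          (of_braid_chain m k).symm
      have := congrArg (fun x => (χ x).left b) hw3
      simp only [left_mul χ hχ, hw, map_one] at this
      exact eq_inv_of_mul_eq_one_left this
    have even : ∀ i b, ε b ≠ 1 → ε (s i * b) = 1 := by
      intro i b h
      rw [map_mul, hε, (Int.units_eq_one_or (ε b)).resolve_left h]
      decide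
    have even_c : ∀ (k : Fin m) b, ε b = 1 → ε (s k.castSucc * s k.succ * b) = 1 := by
      intro k b h
      rw [map_mul, map_mul, hε, hε, h]
      decide
    have extend : ∀ i, (∀ b, ε b = 1 → (φ (PresentedGroup.of i)).left b =
        (ψ (PresentedGroup.of i)).left b) → φ (PresentedGroup.of i) = ψ (PresentedGroup.of i) := by
      intro i h
      refine SemidirectProduct.ext (funext fun b => ?_)
        ((DFunLike.congr_fun hφ _).trans (DFunLike.congr_fun hψ _).symm)
      by_cases hb : ε b = 1
      · exact h b hb
      · rw [odd_eq φ hφ, odd_eq ψ hψ, h _ (even i b hb)]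
    have arrow : ∀ k b, ε b = 1 → (φ (chainArrow m (some k))).left b =
        (ψ (chainArrow m (some k))).left b := by
      intro k b h
      have nonrep : ∀ b, ε b = 1 → ¬ R k b → (φ (chainArrow m (some k))).left b =
          (ψ (chainArrow m (some k))).left b := fun b h hn =>
        (hφ' (some k) b ⟨h, hn⟩).trans (hψ' (some k) b ⟨h, hn⟩).symm
      by_cases hr : R k b
      · obtain ⟨h1, h2⟩ : ¬ R k (s k.castSucc * s k.succ * b) ∧
            ¬ R k (s k.castSucc * s k.succ * (s k.castSucc * s k.succ * b)) := by
          have := hR k b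
          simp only [hr, not_true_eq_false, false_and, or_false, true_and] at this
          exact this
        rw [three φ hφ, three ψ hψ, nonrep _ (even_c _ _ h) h1,
          nonrep _ (even_c _ _ (even_c _ _ h)) h2]
      · exact nonrep b h hr
    refine PresentedGroup.ext fun i => ?_
    -- The values on `y_k` and on `y_{k+1} y_k` determine the value on `y_{k+1}`.
    induction i using Fin.induction with
    | zero => exact extend 0 fun b h => (hφ' none b h).trans (hψ' none b h).symm
    | succ k ih =>
      refine extend _ fun b h => ?_
      have := arrow k b h
      rw [chainArrow, left_mul φ hφ, left_mul ψ hψ, ih] at this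
      exact mul_right_cancel this

/-- The number of generating arrows of the action groupoid. -/
theorem card_chainTarget [Finite Q] (s : Fin (m + 1) → Q)
    (ε : Q →* ℤˣ) (hε : ∀ i, ε (s i) = -1) (R : Fin m → Q → Prop)
    (hR : ∀ k a, let c := s k.castSucc * s k.succ
      (R k a ∧ ¬ R k (c * a) ∧ ¬ R k (c * (c * a))) ∨
      (¬ R k a ∧ R k (c * a) ∧ ¬ R k (c * (c * a))) ∨
      (¬ R k a ∧ ¬ R k (c * a) ∧ R k (c * (c * a)))) :
    6 * Nat.card (Σ e : Option (Fin m), {b : Q // chainTarget ε R e b}) =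
      (3 + 2 * m) * Nat.card Q := by
  classical
  have := Fintype.ofFinite Q
  have key : ∀ e, Nat.card {b : Q // chainTarget ε R e b} =
      ∑ b : Q, if chainTarget ε R e b then 1 else 0 := by
    intro e
    rw [Nat.card_eq_fintype_card, Fintype.card_subtype, Finset.card_filter]
  have even_c : ∀ (k : Fin m) b, ε (s k.castSucc * s k.succ * b) = ε b := by
    intro k b
    rw [map_mul, map_mul, hε, hε]
    simp
  have shift : ∀ (c : Q) (P : Q → ℕ), ∑ b, P (c * b) = ∑ b, P b := fun c P =>
    Equiv.sum_comp (Equiv.mulLeft c) P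
  -- Translation by `s 0` exchanges even and odd elements.
  have h0 : 2 * Nat.card {b : Q // chainTarget ε R none b} = Nat.card Q := by
    have hsum : ∑ b : Q, ((if ε b = 1 then 1 else 0) + if ε (s 0 * b) = 1 then 1 else 0) =
        Nat.card Q := by
      rw [Nat.card_eq_fintype_card, ← Finset.card_univ, Finset.card_eq_sum_ones]
      refine Finset.sum_congr rfl fun b _ => ?_
      rw [map_mul, hε]
      rcases Int.units_eq_one_or (ε b) with h | h <;> simp [h]
    rw [Finset.sum_add_distrib, shift (s 0) (fun b => if ε b = 1 then 1 else 0)] at hsum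
    rw [key, two_mul]
    convert! hsum
  -- Translation by `s k * s (k+1)` preserves parity, and two of the three elements in each even
  -- orbit are counted.
  have hk : ∀ k : Fin m, 3 * Nat.card {b : Q // chainTarget ε R (some k) b} = Nat.card Q := by
    intro k
    let P : Q → ℕ := fun b => if chainTarget ε R (some k) b then 1 else 0
    let c := s k.castSucc * s k.succ
    have hsum : ∑ b : Q, (P b + P (c * b) + P (c * (c * b))) =
        2 * Nat.card {b : Q // chainTarget ε R none b} := by
      rw [key, Finset.mul_sum]
      refine Finset.sum_congr rfl fun b _ => ?_
      simp only [P, c, chainTarget, even_c]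
      by_cases h : ε b = 1
      · rcases hR k b with ⟨h1, h2, h3⟩ | ⟨h1, h2, h3⟩ | ⟨h1, h2, h3⟩ <;> simp [h, h1, h2, h3]
      · simp [h]
    rw [Finset.sum_add_distrib, Finset.sum_add_distrib, shift c (fun b => P (c * b)),
      shift c P, h0] at hsum
    rw [key]
    simp only [P] at hsum
    omega
  rw [Nat.card_sigma, Fintype.sum_option, mul_add, Finset.mul_sum,
    Finset.sum_congr rfl (fun k _ => show _ = 2 * Nat.card Q from by rw [← hk k]; ring)]
  simp only [Finset.sum_const, Finset.card_univ, Fintype.card_fin, smul_eq_mul]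
  rw [show 6 * Nat.card {b : Q // chainTarget ε R none b} = 3 * Nat.card Q by rw [← h0]; ring]
  ring

end Chain

/-! ### Freeness and rank of the kernel -/

/-- The kernel of a sign-compatible surjection from the chain group onto a finite group `Q` that
separates consecutive generators is free. -/
theorem exists_ker_mulEquiv_freeGroup {m : ℕ} {Q : Type} [Group Q] [Finite Q]
    (π : PresentedGroup (chainRels m) →* Q) (hπ : Function.Surjective π)
    (ε : Q →* ℤˣ) (hε : ∀ i, ε (π (PresentedGroup.of i)) = -1)
    (hne : ∀ k : Fin m, π (PresentedGroup.of k.castSucc) ≠ π (PresentedGroup.of k.succ)) :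
    ∃ r : ℕ, 6 * r + 6 * Nat.card Q = (3 + 2 * m) * Nat.card Q + 6 ∧
      Nonempty (π.ker ≃* FreeGroup (Fin r)) := by
  let s : Fin (m + 1) → Q := fun i => π (PresentedGroup.of i)
  have hs : ∀ i, s i * s i = 1 := fun i => by
    simp only [s, ← map_mul, of_mul_self_chain, map_one]
  have hb : ∀ k : Fin m, s k.castSucc * s k.succ * s k.castSucc =
      s k.succ * s k.castSucc * s k.succ := fun k => by
    simp only [s, ← map_mul, of_braid_chain]
  have hex : ∀ k : Fin m, ∃ R : Q → Prop, ∀ a, let c := s k.castSucc * s k.succ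
      (R a ∧ ¬ R (c * a) ∧ ¬ R (c * (c * a))) ∨ (¬ R a ∧ R (c * a) ∧ ¬ R (c * (c * a))) ∨
      (¬ R a ∧ ¬ R (c * a) ∧ R (c * (c * a))) := by
    intro k
    refine exists_orbit_representatives (Equiv.mulLeft (s k.castSucc * s k.succ)) ?_ ?_
    · intro a
      simp only [Equiv.coe_mulLeft]
      rw [← mul_assoc, ← mul_assoc, cube_eq_one_of_braid (hs _) (hs _) (hb k), one_mul]
    · intro a h
      have h1 : s k.castSucc * s k.succ = 1 := mul_eq_right.1 h
      exact hne k (mul_right_cancel (h1.trans (hs k.succ).symm))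
  choose R hR using hex
  let _ : MulAction (PresentedGroup (chainRels m)) Q := MulAction.compHom Q π
  have smul_def : ∀ (x : PresentedGroup (chainRels m)) (b : Q), x • b = π x * b := fun _ _ => rfl
  have : MulAction.IsPretransitive (PresentedGroup (chainRels m)) Q := ⟨fun a b => by
    obtain ⟨x, hx⟩ := hπ (b * a⁻¹)
    exact ⟨x, by rw [smul_def, hx, inv_mul_cancel_right]⟩⟩
  have : Nonempty Q := ⟨1⟩
  let _ : IsFreeGroupoid (ActionCategory (PresentedGroup (chainRels m)) Q) :=
    isFreeGroupoidAction (chainArrow m) (chainTarget ε R)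
      fun X _ l => existsUnique_crossedHom π ε hε R hR X l
  have hconn : CategoryTheory.IsConnected (ActionCategory (PresentedGroup (chainRels m)) Q) :=
    inferInstance
  -- The same connectedness, stated for the category structure underlying the groupoid.
  have : @CategoryTheory.IsConnected (ActionCategory (PresentedGroup (chainRels m)) Q)
    Groupoid.toCategory := hconn
  have : Finite (ActionCategory (PresentedGroup (chainRels m)) Q) :=
    Finite.of_equiv Q (objEquiv _ Q)
  let e := totalActionQuiverEquiv (chainArrow m) (chainTarget ε R)
  have : Finite (Quiver.Total (IsFreeGroupoid.Generators
      (ActionCategory (PresentedGroup (chainRels m)) Q))) := Finite.of_equiv _ e.symm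
  obtain ⟨r, hr, ⟨E⟩⟩ := IsFreeGroupoid.exists_end_mulEquiv
    (objEquiv (PresentedGroup (chainRels m)) Q 1)
  have hc := Nat.card_congr e
  have hE := card_chainTarget s ε hε R hR
  have hQ := Nat.card_congr (objEquiv (PresentedGroup (chainRels m)) Q)
  refine ⟨r, ?_, ⟨?_⟩⟩
  · rw [← hE, ← hc, hQ, ← mul_add, hr, mul_add]
  · have F : MulAction.stabilizerSubmonoid (PresentedGroup (chainRels m)) (1 : Q) ≃*
        @End _ Groupoid.toCategory.toCategoryStruct
          (objEquiv (PresentedGroup (chainRels m)) Q 1) :=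
      stabilizerIsoEnd (PresentedGroup (chainRels m)) (1 : Q)
    refine MulEquiv.trans ?_ (F.trans E)
    refine
      { toFun := fun x => ⟨x.1, by
          have := x.2
          rw [MonoidHom.mem_ker] at this
          rw [MulAction.mem_stabilizerSubmonoid_iff, smul_def, this, one_mul]⟩
        invFun := fun x => ⟨x.1, by
          have := x.2
          rw [MulAction.mem_stabilizerSubmonoid_iff, smul_def, mul_one] at this
          exact this⟩
        left_inv := fun _ => rfl
        right_inv := fun _ => rfl
        map_mul' := fun _ _ => rfl }

theorem tripletToPerm_surjective (m : ℕ) : Function.Surjective (tripletToPerm (m + 2)) := by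
  rw [← MonoidHom.mrange_eq_top, eq_top_iff, ← Equiv.Perm.mclosure_swap_castSucc_succ (m + 1),
    Submonoid.closure_le]
  rintro _ ⟨i, rfl⟩
  exact ⟨PresentedGroup.of i, PresentedGroup.toGroup.of _⟩

/-- The rank formula for the pure triplet group. -/
theorem exists_pureTripletGroup_mulEquiv (m : ℕ) :
    ∃ r : ℕ, 6 * r + 6 * (m + 2).factorial = (3 + 2 * m) * (m + 2).factorial + 6 ∧
      Nonempty (PureTripletGroup (m + 2) ≃* FreeGroup (Fin r)) := by
  -- The relator set is made a variable so that its equality with `chainRels m` can be substituted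
  -- into the type of the presented group.
  have key : ∀ (rels : Set (FreeGroup (Fin (m + 1)))), rels = chainRels m →
      ∀ π : PresentedGroup rels →* Equiv.Perm (Fin (m + 2)), Function.Surjective π →
      (∀ i : Fin (m + 1), π (PresentedGroup.of i) = Equiv.swap i.castSucc i.succ) →
      ∃ r : ℕ, 6 * r + 6 * (m + 2).factorial = (3 + 2 * m) * (m + 2).factorial + 6 ∧
        Nonempty (π.ker ≃* FreeGroup (Fin r)) := by
    rintro _ rfl π hπ hof
    have := exists_ker_mulEquiv_freeGroup π hπ Equiv.Perm.sign
      (fun i => by rw [hof, Equiv.Perm.sign_swap (Fin.castSucc_lt_succ).ne])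
      (fun k h => by
        rw [hof, hof] at h
        -- The first transposition moves this point and the second fixes it.
        have h1 := DFunLike.congr_fun h k.castSucc.castSucc
        rw [Equiv.swap_apply_left, Equiv.swap_apply_of_ne_of_ne] at h1
        · exact (Fin.castSucc_lt_succ).ne h1.symm
        · simp [Fin.ext_iff]
        · simp only [ne_eq, Fin.ext_iff, Fin.val_castSucc, Fin.val_succ]
          omega)
    rwa [Nat.card_perm, Nat.card_fin] at this
  exact key _ (tripletRels_eq_chainRels m) (tripletToPerm (m + 2)) (tripletToPerm_surjective m)
    fun i => PresentedGroup.toGroup.of _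

theorem proposition4p11 :
    (∀ n : ℕ, 4 ≤ n →
      ∃ r : ℕ, (r : ℚ) = 1 + (n.factorial : ℚ) * ((2 * (n : ℚ) - 7) / 6) ∧
        Nonempty (PureTripletGroup n ≃* FreeGroup (Fin r))) ∧
    Nonempty (PureTripletGroup 4 ≃* FreeGroup (Fin 5)) ∧
    Nonempty (PureTripletGroup 5 ≃* FreeGroup (Fin 61)) := by
  refine ⟨fun n hn => ?_, ?_, ?_⟩
  · obtain ⟨m, rfl⟩ : ∃ m, n = m + 2 := ⟨n - 2, by omega⟩
    obtain ⟨r, hr, h⟩ := exists_pureTripletGroup_mulEquiv m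
    refine ⟨r, ?_, h⟩
    have hr' : (6 * r + 6 * (m + 2).factorial : ℚ) = (3 + 2 * m) * (m + 2).factorial + 6 := by
      exact_mod_cast hr
    push_cast
    linear_combination hr' / 6
  · obtain ⟨r, hr, h⟩ := exists_pureTripletGroup_mulEquiv 2
    obtain rfl : r = 5 := by simp [Nat.factorial] at hr; omega
    exact h
  · obtain ⟨r, hr, h⟩ := exists_pureTripletGroup_mulEquiv 3
    obtain rfl : r = 61 := by simp [Nat.factorial] at hr; omega
    exact h
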